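/- Let $t\ge 1$, let $W_1,\dots,W_t$ be infinite, finitely generated subgroups of $\mathbb{Q}^\times$, and let $k_1,\dots,k_t$ be positive integers. Let $F$ be a finite Galois extension of $\mathbb{Q}$, contained in a fixed algebraically closed field $\Omega$ of characteristic $0$, and let $C\subseteq \mathrm{Gal}(F/\mathbb{Q})$ be a union of conjugacy classes (for example a single conjugacy class). For a prime $\ell$ and $1\le i\le t$ let $q_i(\ell)$ be the smallest power of $\ell$ not dividing $k_i$, and put $$L_\ell=\mathbb{Q}\bigl(\zeta_{\max(q_1(\ell),\dots,q_t(\ell))},\,W_1^{1/q_1(\ell)},\dots,W_t^{1/q_t(\ell)}\bigr)\subseteq\Omega ,$$ where $\zeta_m$ is a primitive $m$th root of unity and $W^{1/m}$ is the set of $m$th roots in $\Omega$ of the elements of $W$. For a squarefree positive integer $n$ let $L_n$ be the compositum of the fields $L_\ell$, $\ell\mid n$ prime (so $L_1=\mathbb{Q}$). Let $C_n$ be the set of those $\sigma\in\mathrm{Gal}(FL_n/\mathbb{Q})$ such that $\sigma|_F\in C$ and such that, for every prime $\ell\mid n$ and every $1\le i\le t$, $\sigma$ is not the identity on $\mathbb{Q}(\zeta_{q_i(\ell)},W_i^{1/q_i(\ell)})$.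 Put $$d_n=\frac{|C_n|}{|\mathrm{Gal}(FL_n/\mathbb{Q})|}.$$ If $d_n\neq 0$ for all squarefree positive integers $n$, then the limit $d_\infty$ of $d_n$, as $n$ runs through the squarefree positive integers ordered by divisibility, exists and $d_\infty\neq 0$. (Here $d_\infty$ is the limit means: for every $\varepsilon>0$ there is a squarefree positive integer $N$ such that $|d_\infty-d_n|<\varepsilon$ for all squarefree positive integers $n$ divisible by $N$.) -/

import Mathlib

namespace MultiArtin

noncomputable section

/-- The smallest power of the prime `ℓ` that does not divide the positive integer `k`. -/
def qPow (k ℓ : ℕ) : ℕ := sInf {q : ℕ | (∃ m : ℕ, q = ℓ ^ m) ∧ ¬ q ∣ k}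

/-- `W^{1/q}`: all `q`-th roots, in the algebraically closed field `Ω`, of the elements of `W`. -/
def rootSet (Ω : Type*) [Field Ω] [CharZero Ω] (W : Subgroup ℚˣ) (q : ℕ) : Set Ω :=
  {z : Ω | ∃ w ∈ W, z ^ q = ((w : ℚ) : Ω)}

/-- The field `ℚ(ζ_q, W^{1/q})`. -/
def kummerField (Ω : Type*) [Field Ω] [CharZero Ω] (W : Subgroup ℚˣ) (q : ℕ) :
    IntermediateField ℚ Ω :=
  IntermediateField.adjoin ℚ ({z : Ω | IsPrimitiveRoot z q} ∪ rootSet Ω W q)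

/-- The field `L_ℓ = ℚ(ζ_{max_i q_i(ℓ)}, W_1^{1/q_1(ℓ)}, …, W_t^{1/q_t(ℓ)})`, where
`q_i(ℓ) = qPow (k i) ℓ`. -/
def primeField (Ω : Type*) [Field Ω] [CharZero Ω] {t : ℕ} (W : Fin t → Subgroup ℚˣ)
    (k : Fin t → ℕ) (ℓ : ℕ) : IntermediateField ℚ Ω :=
  IntermediateField.adjoin ℚ
    ({z : Ω | IsPrimitiveRoot z (Finset.univ.sup fun i => qPow (k i) ℓ)} ∪
      ⋃ i, rootSet Ω (W i) (qPow (k i) ℓ))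

/-- The field `L_n`, the compositum of the `L_ℓ` over the primes `ℓ ∣ n`. -/
def levelField (Ω : Type*) [Field Ω] [CharZero Ω] {t : ℕ} (W : Fin t → Subgroup ℚˣ)
    (k : Fin t → ℕ) (n : ℕ) : IntermediateField ℚ Ω :=
  ⨆ ℓ ∈ n.primeFactors, primeField Ω W k ℓ

variable {Ω : Type*} [Field Ω] [CharZero Ω] {t : ℕ}

/-- The set `C_n` of those `σ ∈ Gal(F L_n / ℚ)` whose restriction to `F` lies in `C` and which,
for every prime `ℓ ∣ n` and every `i`, are not the identity on `ℚ(ζ_{q_i(ℓ)}, W_i^{1/q_i(ℓ)})`. -/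
def localSet (W : Fin t → Subgroup ℚˣ) (k : Fin t → ℕ) (F : IntermediateField ℚ Ω)
    (C : Set (F ≃ₐ[ℚ] F)) (n : ℕ) :
    Set (↥(F ⊔ levelField Ω W k n) ≃ₐ[ℚ] ↥(F ⊔ levelField Ω W k n)) :=
  {σ | (∃ τ ∈ C, ∀ x : F, σ (IntermediateField.inclusion le_sup_left x) =
          IntermediateField.inclusion le_sup_left (τ x)) ∧
       ∀ ℓ ∈ n.primeFactors, ∀ i : Fin t,
          ¬ ∀ x : ↥(F ⊔ levelField Ω W k n),
              (x : Ω) ∈ kummerField Ω (W i) (qPow (k i) ℓ) → σ x = x}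

/-- The local density `d_n = |C_n| / |Gal(F L_n / ℚ)|`. -/
def localDensity (W : Fin t → Subgroup ℚˣ) (k : Fin t → ℕ) (F : IntermediateField ℚ Ω)
    (C : Set (F ≃ₐ[ℚ] F)) (n : ℕ) : ℝ :=
  (Nat.card (localSet W k F C n) : ℝ) /
    (Nat.card (↥(F ⊔ levelField Ω W k n) ≃ₐ[ℚ] ↥(F ⊔ levelField Ω W k n)) : ℝ)

/-- `a` is the limit of `d n` as `n` runs through the squarefree positive integers ordered by
divisibility. -/
def IsSquarefreeLimit (d : ℕ → ℝ) (a : ℝ) : Prop :=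
  ∀ ε : ℝ, 0 < ε → ∃ N : ℕ, Squarefree N ∧ ∀ n : ℕ, Squarefree n → N ∣ n → |a - d n| < ε

/-- The limit along the squarefree positive integers ordered by divisibility is unique. -/
theorem IsSquarefreeLimit.unique {d : ℕ → ℝ} {a b : ℝ} (ha : IsSquarefreeLimit d a)
    (hb : IsSquarefreeLimit d b) : a = b := by
  by_contra hab
  have hpos : 0 < |a - b| / 2 := by
    have := abs_pos.mpr (sub_ne_zero.mpr hab)
    linarith
  obtain ⟨N, hN, hN'⟩ := ha _ hpos
  obtain ⟨M, hM, hM'⟩ := hb _ hpos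
  have hsq : Squarefree (N.lcm M) := by
    have h0 : N.lcm M ≠ 0 := Nat.lcm_ne_zero hN.ne_zero hM.ne_zero
    rw [Nat.squarefree_iff_factorization_le_one h0]
    intro p
    rw [Nat.factorization_lcm hN.ne_zero hM.ne_zero, Finsupp.sup_apply]
    exact sup_le (hN.natFactorization_le_one p) (hM.natFactorization_le_one p)
  have h1 := hN' _ hsq (Nat.dvd_lcm_left N M)
  have h2 := hM' _ hsq (Nat.dvd_lcm_right N M)
  have h3 := abs_sub_le a (d (N.lcm M)) b
  rw [abs_sub_comm (d (N.lcm M)) b] at h3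
  linarith

end

end MultiArtin

/-! The densities are nonnegative and decrease along divisibility (`localDensity_antitone`), so they
converge to their infimum. The issue is a positive lower bound, and it suffices to find one
squarefree N with d_n ≥ d_N / 2 for every nonzero multiple n of N.

Take N to be the product of the primes up to a large x. A prime ℓ > x satisfies q_i(ℓ) = ℓ, F L_N is
unramified at ℓ, and each W_i contains a rational that is not an ℓ-th power. Hence the Kummer field
of W_i at ℓ has degree divisible by ℓ(ℓ-1) over F L_N (`mul_dvd_finrank_sup_kummerField`), and among
the lifts of C_N a proportion of at most 1/(ℓ(ℓ-1)) is trivial on it. A union bound over ℓ > x and i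
loses at most t/x ≤ 1/2 of the lifts (`localDensity_sub_le`). No independence between different
large primes is needed.

Total ramification of ζ_ℓ enters by embedding unramified fields into the fraction field of the Witt
vectors of an algebraic closure of 𝔽_ℓ, where the ℓ-th cyclotomic polynomial stays irreducible. -/

namespace MultiArtin

open Polynomial

/-! ### Splitting and irreducibility over Witt vectors -/

section WittVectors

variable (p : ℕ) [Fact p.Prime] (k : Type*) [Field k] [CharP k p]

theorem charZero_wittVector : CharZero (WittVector p k) := by
  obtain ⟨q, hq⟩ := CharP.exists (WittVector p k)
  rcases CharP.char_is_prime_or_zero (WittVector p k) q with hq' | rfl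
  · exfalso
    have h0 : ((q : ℕ) : k) = 0 := by
      rw [← map_natCast (WittVector.constantCoeff : WittVector p k →+* k),
        CharP.cast_eq_zero (WittVector p k) q, map_zero]
    have hpq : p ∣ q := (CharP.cast_eq_zero_iff k p q).1 h0
    have : p = q := (Nat.prime_dvd_prime_iff_eq Fact.out hq').1 hpq
    subst this
    exact (WittVector.irreducible p (k := k)).ne_zero (CharP.cast_eq_zero (WittVector p k) p)
  · exact CharP.charP_to_charZero _

variable [IsAlgClosed k]

/-- Hensel's lemma: simple roots lift from the residue field to the Witt vectors. -/
theorem exists_root_wittVector {f : (WittVector p k)[X]} (hf : f.Monic) {α : k}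
    (hα : (f.map WittVector.constantCoeff).eval α = 0)
    (hα' : (derivative (f.map WittVector.constantCoeff)).eval α ≠ 0) :
    ∃ a : WittVector p k, f.IsRoot a ∧ WittVector.constantCoeff a = α := by
  obtain ⟨a₀, rfl⟩ := WittVector.constantCoeff_surjective (p := p) α
  rw [eval_map_apply] at hα
  rw [derivative_map, eval_map_apply] at hα'
  have hmem : ∀ x : WittVector p k, x ∈ Ideal.span {(p : WittVector p k)} ↔
      WittVector.constantCoeff x = 0 := fun x => by
    rw [← WittVector.ker_constantCoeff, RingHom.mem_ker]
  obtain ⟨a, ha, haa⟩ := HenselianRing.is_henselian (I := Ideal.span {(p : WittVector p k)})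
    f hf a₀ ((hmem _).2 hα)
    ((WittVector.isUnit_of_coeff_zero_ne_zero _ hα').map (Ideal.Quotient.mk _))
  refine ⟨a, ha, ?_⟩
  rw [hmem, map_sub, sub_eq_zero] at haa
  exact haa

/-- Each of the deg f distinct roots of the reduction lifts, so f already has deg f roots. -/
theorem splits_wittVector {f : (WittVector p k)[X]} (hf : f.Monic)
    (hsep : (f.map WittVector.constantCoeff).Separable) : f.Splits := by
  rw [splits_iff_card_roots]
  refine le_antisymm (card_roots' f) ?_
  have hk : (f.map WittVector.constantCoeff).roots.card = f.natDegree := by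
    rw [splits_iff_card_roots.1 (IsAlgClosed.splits _), hf.natDegree_map]
  rw [← hk, ← Multiset.card_map WittVector.constantCoeff f.roots]
  refine Multiset.card_le_card ((Multiset.le_iff_subset (nodup_roots hsep)).2 fun α hα => ?_)
  have hα0 := (mem_roots'.1 hα).2
  obtain ⟨a, ha, rfl⟩ := exists_root_wittVector p k hf hα0
    (hsep.aeval_derivative_ne_zero (x := α) (by simpa [IsRoot] using hα0))
  exact Multiset.mem_map_of_mem _ ((mem_roots hf.ne_zero).2 ha)

/-- Shifting by 1 gives an Eisenstein polynomial over ℤ, and it remains Eisenstein because p is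
still prime in the Witt vectors. -/
theorem irreducible_cyclotomic_wittVector : Irreducible (cyclotomic p (WittVector p k)) := by
  have hpr : Prime (p : WittVector p k) := (WittVector.irreducible p).prime
  have hI := (Ideal.span_singleton_prime hpr.ne_zero).2 hpr
  set g : ℤ[X] := (cyclotomic p ℤ).comp (X + 1) with hg
  have hgm : g.Monic := (cyclotomic.monic p ℤ).comp_X_add_C 1
  have hgE := cyclotomic_comp_X_add_one_isEisensteinAt p
  have hdeg : g.natDegree = p - 1 := by
    rw [hg, show (X + 1 : ℤ[X]) = X + C 1 by simp, natDegree_comp, natDegree_X_add_C, mul_one,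
      natDegree_cyclotomic, Nat.totient_prime Fact.out]
  set h := g.map (Int.castRingHom (WittVector p k)) with hh
  have hhm : h.Monic := hgm.map _
  have hhdeg : h.natDegree = p - 1 := by rw [hh, hgm.natDegree_map, hdeg]
  have h2 : 2 ≤ p := (Fact.out : p.Prime).two_le
  have hE : h.IsEisensteinAt (Ideal.span {(p : WittVector p k)}) := by
    refine ⟨?_, ?_, ?_⟩
    · rw [hhm.leadingCoeff]
      exact fun h1 => hI.ne_top ((Ideal.eq_top_iff_one _).2 h1)
    · intro n hn
      rw [hhdeg, ← hdeg] at hn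
      have := hgE.mem hn
      rw [Ideal.submodule_span_eq, Ideal.mem_span_singleton] at this
      rw [hh, coeff_map, Ideal.mem_span_singleton]
      simpa using map_dvd (Int.castRingHom (WittVector p k)) this
    -- The constant term is Φ_p(1) = p, which is not divisible by p².
    · have h0 : h.coeff 0 = p := by
        rw [hh, coeff_map, coeff_zero_eq_eval_zero, hg, eval_comp]
        simp [eval_one_cyclotomic_prime]
      rw [h0, Ideal.span_singleton_pow, Ideal.mem_span_singleton]
      intro ⟨c, hc⟩
      have : (p : WittVector p k) * 1 = p * (p * c) := by rw [mul_one, ← mul_assoc, ← sq]; exact hc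
      exact hpr.not_isUnit (isUnit_of_dvd_one ⟨c, mul_left_cancel₀ hpr.ne_zero this⟩)
  have hirr : Irreducible h := hE.irreducible hI hhm.isPrimitive (by omega)
  have hcomp : h = (cyclotomic p (WittVector p k)).comp (X + C 1) := by
    rw [hh, hg, map_comp, map_cyclotomic]; simp
  rw [hcomp] at hirr
  have := hirr.map (algEquivAevalXAddC (-1 : WittVector p k))
  have h3 : (algEquivAevalXAddC (-1 : WittVector p k))
      ((cyclotomic p (WittVector p k)).comp (X + C 1)) = cyclotomic p (WittVector p k) := by
    rw [algEquivAevalXAddC_apply]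
    change ((cyclotomic p (WittVector p k)).comp (X + C 1)).comp (X + C (-1)) = _
    rw [comp_assoc]
    simp
  rwa [h3] at this

end WittVectors

/-! ### Fields unramified at a prime -/

variable (Ω : Type*) [Field Ω] [CharZero Ω]

/-- The field generated by the roots of the monic integral polynomials that are separable
modulo `ℓ`; it is unramified at `ℓ`. -/
def unramifiedField (ℓ : ℕ) : IntermediateField ℚ Ω :=
  IntermediateField.adjoin ℚ {z | ∃ f : ℤ[X], f.Monic ∧
    (f.map (Int.castRingHom (ZMod ℓ))).Separable ∧ aeval z f = 0}

variable {Ω}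

theorem mem_unramifiedField_of_mul_mem {ℓ : ℕ} {c : ℤ} (hc : c ≠ 0) {z : Ω}
    (h : (c : Ω) * z ∈ unramifiedField Ω ℓ) : z ∈ unramifiedField Ω ℓ := by
  have hc' : (c : Ω) ≠ 0 := by exact_mod_cast hc
  have := mul_mem (inv_mem (intCast_mem (unramifiedField Ω ℓ) c)) h
  rwa [inv_mul_cancel_left₀ hc'] at this

/-- The generators of the unramified field have conjugates in K = Frac W(k), so E embeds in K;
irreducibility over K then descends to E. -/
theorem irreducible_cyclotomic_of_le_unramifiedField {ℓ : ℕ} [Fact ℓ.Prime]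
    {E : IntermediateField ℚ Ω} (hE : E ≤ unramifiedField Ω ℓ) :
    Irreducible (cyclotomic ℓ E) := by
  let k := AlgebraicClosure (ZMod ℓ)
  have : CharZero (WittVector ℓ k) := charZero_wittVector ℓ k
  let K := FractionRing (WittVector ℓ k)
  have : CharZero K := charZero_of_injective_algebraMap (IsFractionRing.injective (WittVector ℓ k) K)
  obtain ⟨φ⟩ : Nonempty (unramifiedField Ω ℓ →ₐ[ℚ] K) := by
    refine IntermediateField.nonempty_algHom_adjoin_of_splits ?_
    rintro z ⟨f, hf, hsep, hz⟩
    have hz' : aeval z (f.map (algebraMap ℤ ℚ)) = 0 := by rw [aeval_map_algebraMap, hz]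
    refine ⟨⟨f.map (algebraMap ℤ ℚ), hf.map _, by rwa [aeval_def] at hz'⟩, ?_⟩
    have h1 : (f.map (Int.castRingHom (WittVector ℓ k))).Splits := by
      refine splits_wittVector ℓ k (hf.map _) ?_
      rw [Polynomial.map_map]
      have := hsep.map (f := algebraMap (ZMod ℓ) k)
      rw [Polynomial.map_map] at this
      convert this using 2
      exact Subsingleton.elim _ _
    have h2 := h1.map (algebraMap (WittVector ℓ k) K)
    rw [Polynomial.map_map] at h2
    refine h2.of_dvd ((hf.map _).ne_zero) ?_
    have h3 := Polynomial.map_dvd (algebraMap ℚ K) (minpoly.dvd ℚ z hz')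
    rw [Polynomial.map_map] at h3
    convert h3 using 2
    exact Subsingleton.elim _ _
  let ψ := φ.comp (IntermediateField.inclusion hE)
  have hK : Irreducible (cyclotomic ℓ K) := by
    have := ((cyclotomic.monic ℓ (WittVector ℓ k)).irreducible_iff_irreducible_map_fraction_map
      (K := K)).1 (irreducible_cyclotomic_wittVector ℓ k)
    rwa [map_cyclotomic] at this
  refine Monic.irreducible_of_irreducible_map (ψ : E →+* K) _
    (cyclotomic.monic _ _) ?_
  rwa [map_cyclotomic]

/-- Clearing the denominator turns z into a root of X^q - c with c an integer; as ℓ divides neither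
q nor c, this is separable modulo ℓ. -/
theorem mem_unramifiedField_of_pow_eq {ℓ : ℕ} [Fact ℓ.Prime] {q : ℕ} (hq : 0 < q) (hℓq : ¬ ℓ ∣ q)
    {w : ℚ} (hw : w ≠ 0) (hw' : padicValRat ℓ w = 0) {z : Ω} (hz : z ^ q = (w : Ω)) :
    z ∈ unramifiedField Ω ℓ := by
  have hcop : ¬ ((ℓ : ℤ) ∣ w.num) ∧ ¬ ℓ ∣ w.den := by
    by_cases h1 : ℓ ∣ w.den
    · have h2 : ¬ ℓ ∣ w.num.natAbs := fun h2 =>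
        (Fact.out : ℓ.Prime).one_lt.ne' (Nat.dvd_one.1 (w.reduced ▸ Nat.dvd_gcd h2 h1))
      have h3 : padicValInt ℓ w.num = 0 := padicValNat.eq_zero_of_not_dvd h2
      have h4 : 1 ≤ padicValNat ℓ w.den := one_le_padicValNat_of_dvd w.den_ne_zero h1
      rw [padicValRat, h3] at hw'
      omega
    · have h3 : padicValNat ℓ w.den = 0 := padicValNat.eq_zero_of_not_dvd h1
      refine ⟨fun h2 => ?_, h1⟩
      have h4 : 1 ≤ padicValInt ℓ w.num :=
        one_le_padicValNat_of_dvd (by simpa using hw) (Int.natCast_dvd.1 h2)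
      rw [padicValRat, h3] at hw'
      omega
  have hd : (w.den : ℤ) ≠ 0 := by exact_mod_cast w.den_ne_zero
  refine mem_unramifiedField_of_mul_mem hd (IntermediateField.subset_adjoin _ _
    ⟨X ^ q - C (w.num * w.den ^ (q - 1)), monic_X_pow_sub_C _ hq.ne', ?_, ?_⟩)
  · rw [Polynomial.map_sub, Polynomial.map_pow, map_X, map_C]
    refine separable_X_pow_sub_C _ ?_ ?_
    · rwa [Ne, CharP.cast_eq_zero_iff (ZMod ℓ) ℓ]
    · have h1 : ((w.num : ℤ) : ZMod ℓ) ≠ 0 := by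
        rw [Ne, ZMod.intCast_zmod_eq_zero_iff_dvd]; exact hcop.1
      have h2 : ((w.den : ℕ) : ZMod ℓ) ≠ 0 := by
        rw [Ne, CharP.cast_eq_zero_iff (ZMod ℓ) ℓ]; exact hcop.2
      simpa using ⟨h1, fun h => absurd h h2⟩
  · have hd' : (w.den : Ω) ≠ 0 := by exact_mod_cast w.den_ne_zero
    have hwn : (w : Ω) = w.num / w.den := Rat.cast_def w
    simp only [map_sub, map_pow, aeval_X, aeval_C, map_mul, mul_pow, hz, hwn]
    obtain ⟨m, rfl⟩ := Nat.exists_eq_succ_of_ne_zero hq.ne'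
    simp
    field_simp
    ring

/-- A Bézout identity between the integral minimal polynomial and its derivative, cleared of
denominators, survives modulo every prime exceeding the resulting constant. -/
theorem exists_bound_mem_unramifiedField {z : Ω} (hz : IsIntegral ℚ z) :
    ∃ B : ℕ, ∀ ℓ : ℕ, ℓ.Prime → B < ℓ → z ∈ unramifiedField Ω ℓ := by
  obtain ⟨c, hc, hint⟩ := ((IsFractionRing.isAlgebraic_iff ℤ ℚ Ω).2
    (isAlgebraic_iff_isIntegral.2 hz)).exists_integral_multiple
  set f := minpoly ℤ (c • z)
  have hf : f.Monic := minpoly.monic hint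
  have hfQ : minpoly ℚ (c • z) = f.map (algebraMap ℤ ℚ) :=
    minpoly.isIntegrallyClosed_eq_field_fractions' ℚ hint
  have hsep : (f.map (algebraMap ℤ ℚ)).Separable := by
    rw [← hfQ]
    exact (minpoly.irreducible (hint.tower_top (A := ℚ))).separable
  obtain ⟨a, b, hab⟩ := hsep
  obtain ⟨d₁, hd₁, h₁⟩ := IsLocalization.integerNormalization_spec (nonZeroDivisors ℤ) a
  obtain ⟨d₂, hd₂, h₂⟩ := IsLocalization.integerNormalization_spec (nonZeroDivisors ℤ) b
  set A := IsLocalization.integerNormalization (nonZeroDivisors ℤ) a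
  set B := IsLocalization.integerNormalization (nonZeroDivisors ℤ) b
  have hAB : C d₂ * A * f + C d₁ * B * derivative f = C (d₁ * d₂) := by
    apply map_injective (algebraMap ℤ ℚ) (algebraMap ℤ ℚ).injective_int
    simp only [Polynomial.map_add, Polynomial.map_mul, map_C, h₁, h₂, ← derivative_map]
    have h3 : ∀ (d : ℤ) (g : ℚ[X]), d • g = C (d : ℚ) * g := fun d g => by
      rw [← Int.cast_smul_eq_zsmul ℚ, smul_eq_C_mul]
    rw [h3, h3]
    simp only [map_mul, eq_intCast]
    linear_combination (C (d₁ : ℚ) * C (d₂ : ℚ)) * hab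
  have hd : d₁ * d₂ ≠ 0 := mul_ne_zero (nonZeroDivisors.ne_zero hd₁) (nonZeroDivisors.ne_zero hd₂)
  refine ⟨(d₁ * d₂).natAbs, fun ℓ hℓ hlt => ?_⟩
  have : Fact ℓ.Prime := ⟨hℓ⟩
  have hu : ((d₁ * d₂ : ℤ) : ZMod ℓ) ≠ 0 := by
    rw [Ne, ZMod.intCast_zmod_eq_zero_iff_dvd, Int.natCast_dvd]
    exact Nat.not_dvd_of_pos_of_lt (Int.natAbs_pos.2 hd) hlt
  have hmap := congrArg (Polynomial.map (Int.castRingHom (ZMod ℓ))) hAB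
  simp only [Polynomial.map_add, Polynomial.map_mul _, ← derivative_map, map_C,
    Int.coe_castRingHom] at hmap
  have hmem : c • z ∈ unramifiedField Ω ℓ := by
    refine IntermediateField.subset_adjoin _ _ ⟨f, hf, ?_, minpoly.aeval _ _⟩
    refine ⟨C ((d₁ * d₂ : ℤ) : ZMod ℓ)⁻¹ * (C (d₂ : ZMod ℓ) * A.map (Int.castRingHom (ZMod ℓ))),
      C ((d₁ * d₂ : ℤ) : ZMod ℓ)⁻¹ * (C (d₁ : ZMod ℓ) * B.map (Int.castRingHom (ZMod ℓ))), ?_⟩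
    rw [mul_assoc, mul_assoc (C _⁻¹), ← mul_add, hmap, ← C_mul, inv_mul_cancel₀ hu, C_1]
  rw [zsmul_eq_mul] at hmem
  exact mem_unramifiedField_of_mul_mem hc hmem

theorem exists_bound_le_unramifiedField (F : IntermediateField ℚ Ω) [FiniteDimensional ℚ F] :
    ∃ B : ℕ, ∀ ℓ : ℕ, ℓ.Prime → B < ℓ → F ≤ unramifiedField Ω ℓ := by
  obtain ⟨s, hs⟩ := IntermediateField.essFiniteType_iff.1 (inferInstance : Algebra.EssFiniteType ℚ F)
  have hint : ∀ z : s, IsIntegral ℚ (z : Ω) := fun z => by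
    have hz : (z : Ω) ∈ F := hs ▸ IntermediateField.subset_adjoin _ _ z.2
    exact (Algebra.IsIntegral.isIntegral (R := ℚ) (⟨z, hz⟩ : F)).map F.val
  choose B hB using fun z : s => exists_bound_mem_unramifiedField (hint z)
  refine ⟨Finset.univ.sup B, fun ℓ hℓ hlt => ?_⟩
  rw [← hs, IntermediateField.adjoin_le_iff]
  exact fun z hz => hB ⟨z, hz⟩ ℓ hℓ ((Finset.le_sup (Finset.mem_univ _)).trans_lt hlt)

end MultiArtin

/-! ### Kummer fields: normality, finiteness, degree -/

namespace MultiArtin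

open Polynomial IntermediateField

section QPow

theorem exists_qPow_eq_pow {k ℓ : ℕ} (hk : 0 < k) (hℓ : ℓ.Prime) : ∃ m : ℕ, qPow k ℓ = ℓ ^ m :=
  (Nat.sInf_mem (s := {q : ℕ | (∃ m : ℕ, q = ℓ ^ m) ∧ ¬ q ∣ k})
    ⟨ℓ ^ k, ⟨k, rfl⟩, Nat.not_dvd_of_pos_of_lt hk (Nat.lt_pow_self hℓ.one_lt)⟩).1

theorem qPow_pos {k ℓ : ℕ} (hk : 0 < k) (hℓ : ℓ.Prime) : 0 < qPow k ℓ := by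
  obtain ⟨m, hm⟩ := exists_qPow_eq_pow hk hℓ
  exact hm ▸ pow_pos hℓ.pos m

theorem not_dvd_qPow {k ℓ p : ℕ} (hk : 0 < k) (hℓ : ℓ.Prime) (hp : p.Prime) (hne : p ≠ ℓ) :
    ¬ p ∣ qPow k ℓ := by
  obtain ⟨m, hm⟩ := exists_qPow_eq_pow hk hℓ
  rw [hm]
  exact fun h => hne ((Nat.prime_dvd_prime_iff_eq hp hℓ).1 (hp.dvd_of_dvd_pow h))

theorem qPow_eq_self {k ℓ : ℕ} (h : ¬ ℓ ∣ k) : qPow k ℓ = ℓ := by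
  refine le_antisymm (Nat.sInf_le ⟨⟨1, (pow_one ℓ).symm⟩, h⟩) ?_
  obtain ⟨⟨m, hm⟩, hnd⟩ := Nat.sInf_mem (s := {q : ℕ | (∃ m : ℕ, q = ℓ ^ m) ∧ ¬ q ∣ k})
    ⟨ℓ, ⟨1, (pow_one ℓ).symm⟩, h⟩
  rcases m with _ | m
  · exact absurd (by rw [hm, pow_zero]; exact one_dvd k) hnd
  · change ℓ ≤ sInf _
    rw [hm]
    exact Nat.le_self_pow (by omega) ℓ

end QPow

variable {Ω : Type*} [Field Ω] [CharZero Ω]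

theorem mem_rootSet_of_pow_eq_one (W : Subgroup ℚˣ) {q : ℕ} {z : Ω} (hz : z ^ q = 1) :
    z ∈ rootSet Ω W q := ⟨1, W.one_mem, by simpa using hz⟩

theorem kummerField_eq_adjoin (W : Subgroup ℚˣ) (q : ℕ) :
    kummerField Ω W q = adjoin ℚ (rootSet Ω W q) := by
  rw [kummerField, Set.union_eq_self_of_subset_left]
  exact fun z hz => mem_rootSet_of_pow_eq_one W (IsPrimitiveRoot.pow_eq_one hz)

theorem mem_kummerField {W : Subgroup ℚˣ} {q : ℕ} {z : Ω} {w : ℚˣ} (hw : w ∈ W)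
    (hz : z ^ q = ((w : ℚ) : Ω)) : z ∈ kummerField Ω W q :=
  subset_adjoin _ _ (Or.inr ⟨w, hw, hz⟩)

/-- The maximum of the q_i(ℓ) is attained when t > 0, so the extra root of unity is itself a root of
1 ∈ W_i for some i. -/
theorem primeField_eq_iSup {t : ℕ} (ht : 0 < t) (W : Fin t → Subgroup ℚˣ) (k : Fin t → ℕ) (ℓ : ℕ) :
    primeField Ω W k ℓ = ⨆ i, kummerField Ω (W i) (qPow (k i) ℓ) := by
  have : Nonempty (Fin t) := ⟨⟨0, ht⟩⟩
  simp only [kummerField_eq_adjoin, ← adjoin_iUnion]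
  rw [primeField, Set.union_eq_self_of_subset_left]
  intro z hz
  obtain ⟨i, -, hi⟩ := Finset.exists_mem_eq_sup Finset.univ Finset.univ_nonempty
    fun i => qPow (k i) ℓ
  rw [hi] at hz
  exact Set.mem_iUnion.2 ⟨i, mem_rootSet_of_pow_eq_one _ (IsPrimitiveRoot.pow_eq_one hz)⟩

theorem isIntegral_of_pow_eq {q : ℕ} (hq : 0 < q) {z : Ω} {w : ℚ} (hz : z ^ q = (w : Ω)) :
    IsIntegral ℚ z :=
  ⟨X ^ q - C w, monic_X_pow_sub_C _ hq.ne', by simp [hz]⟩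

theorem kummerField_le_unramifiedField {W : Subgroup ℚˣ} {q ℓ : ℕ} [Fact ℓ.Prime] (hq : 0 < q)
    (hℓq : ¬ ℓ ∣ q) (hW : ∀ w ∈ W, padicValRat ℓ (w : ℚ) = 0) :
    kummerField Ω W q ≤ unramifiedField Ω ℓ := by
  rw [kummerField_eq_adjoin, adjoin_le_iff]
  rintro z ⟨w, hw, hz⟩
  exact mem_unramifiedField_of_pow_eq hq hℓq w.ne_zero (hW w hw) hz

section IsAlgClosed

variable [IsAlgClosed Ω]

theorem normal_kummerField (W : Subgroup ℚˣ) {q : ℕ} (hq : 0 < q) :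
    Normal ℚ (kummerField Ω W q) := by
  have hspl : ∀ z ∈ rootSet Ω W q, IsIntegral ℚ z ∧
      ((minpoly ℚ z).map (algebraMap ℚ (kummerField Ω W q))).Splits := by
    rintro z ⟨w, hw, hz⟩
    refine ⟨isIntegral_of_pow_eq hq hz, ?_⟩
    have h0 : aeval z (X ^ q - C (w : ℚ)) = 0 := by simp [hz]
    refine splits_of_splits (IsAlgClosed.splits _) fun x hx => ?_
    have hx0 : aeval x (X ^ q - C (w : ℚ)) = 0 :=
      aeval_eq_zero_of_dvd_aeval_eq_zero (minpoly.dvd ℚ z h0) (mem_rootSet'.1 hx).2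
    refine mem_kummerField hw ?_
    simpa [sub_eq_zero] using hx0
  have hmem : ∀ x : kummerField Ω W q, (x : Ω) ∈ adjoin ℚ (rootSet Ω W q) := fun x => by
    rw [← kummerField_eq_adjoin]; exact x.2
  refine normal_iff.2 fun x => ?_
  have halg : Algebra.IsAlgebraic ℚ (adjoin ℚ (rootSet Ω W q)) :=
    isAlgebraic_adjoin fun z hz => (hspl z hz).1
  have hx := splits_of_mem_adjoin ℚ Ω hspl (hmem x)
  refine ⟨?_, by
    rwa [← minpoly.algebraMap_eq (A := ℚ) (B' := Ω) (algebraMap (kummerField Ω W q) Ω).injective x]⟩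
  have := (Algebra.IsIntegral.isIntegral (R := ℚ) (⟨x, hmem x⟩ : adjoin ℚ (rootSet Ω W q))).map
    (adjoin ℚ (rootSet Ω W q)).val
  exact (isIntegral_algHom_iff (kummerField Ω W q).val Subtype.val_injective).1 this

theorem finiteDimensional_kummerField {W : Subgroup ℚˣ} (hW : W.FG) {q : ℕ} (hq : 0 < q) :
    FiniteDimensional ℚ (kummerField Ω W q) := by
  obtain ⟨S, rfl⟩ := hW
  choose r hr using fun w : ℚˣ => IsAlgClosed.exists_pow_nat_eq ((w : ℚ) : Ω) hq
  -- Up to q-th roots of unity, the chosen roots are multiplicative, so roots of generators suffice.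
  let T : Set Ω := (r '' (S : Set ℚˣ)) ∪ {z | z ^ q = 1}
  have hTint : ∀ z ∈ T, IsIntegral ℚ z := by
    rintro z (⟨w, -, rfl⟩ | hz)
    · exact isIntegral_of_pow_eq hq (hr w)
    · exact isIntegral_of_pow_eq (w := 1) hq (by simpa using hz)
  have hTfin : T.Finite := by
    refine (S.finite_toSet.image r).union ?_
    refine (nthRoots q (1 : Ω)).finite_toSet.subset fun z hz => ?_
    exact (mem_nthRoots hq).2 hz
  have : FiniteDimensional ℚ (adjoin ℚ T) :=
    have : Finite T := hTfin
    finiteDimensional_adjoin hTint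
  have hroot : ∀ w ∈ Subgroup.closure (S : Set ℚˣ), r w ∈ adjoin ℚ T := by
    have hone : ∀ z : Ω, z ^ q = 1 → z ∈ adjoin ℚ T := fun z hz => subset_adjoin _ _ (Or.inr hz)
    have hne : ∀ w, r w ≠ 0 := fun w h => by
      have := hr w
      rw [h, zero_pow hq.ne'] at this
      exact w.ne_zero (by exact_mod_cast this.symm)
    intro w hw
    induction hw using Subgroup.closure_induction with
    | mem w hw => exact subset_adjoin _ _ (Or.inl ⟨w, hw, rfl⟩)
    | one => exact hone _ (by simp [hr])
    | mul u v _ _ hu hv =>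
      have h1 := hone (r (u * v) / (r u * r v)) (by
        rw [div_pow, mul_pow, hr, hr, hr, Units.val_mul, Rat.cast_mul]
        exact div_self (mul_ne_zero (by simp) (by simp)))
      have := mul_mem h1 (mul_mem hu hv)
      rwa [div_mul_cancel₀ _ (mul_ne_zero (hne u) (hne v))] at this
    | inv u _ hu =>
      have h1 := hone (r u⁻¹ * r u) (by rw [mul_pow, hr, hr]; simp)
      have := mul_mem h1 (inv_mem hu)
      rwa [mul_inv_cancel_right₀ (hne u)] at this
  have hle : kummerField Ω (Subgroup.closure (S : Set ℚˣ)) q ≤ adjoin ℚ T := by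
    rw [kummerField_eq_adjoin, adjoin_le_iff]
    rintro z ⟨w, hw, hz⟩
    have hw0 : ((w : ℚ) : Ω) ≠ 0 := by simp
    have hr0 : r w ≠ 0 := fun h => hw0 (by rw [← hr w, h, zero_pow hq.ne'])
    have h1 : z / r w ∈ adjoin ℚ T :=
      subset_adjoin _ _ (Or.inr (by change _ ^ q = 1; rw [div_pow, hz, hr, div_self hw0]))
    have := mul_mem h1 (hroot w hw)
    rwa [div_mul_cancel₀ _ hr0] at this
  exact FiniteDimensional.of_injective (inclusion hle).toLinearMap (inclusion_injective hle)

/-- If `E / ℚ` is finite Galois and unramified at `ℓ`, then adjoining to `E` the `ℓ`-th roots of a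
group containing a rational that is not an `ℓ`-th power is an extension of degree divisible by
`ℓ (ℓ - 1)`. -/
theorem mul_dvd_finrank_sup_kummerField {ℓ : ℕ} [Fact ℓ.Prime] (h2 : 2 < ℓ)
    {E : IntermediateField ℚ Ω} [Normal ℚ E] (hE : E ≤ unramifiedField Ω ℓ) {W : Subgroup ℚˣ}
    {w : ℚˣ} (hw : w ∈ W) (hpow : ∀ r : ℚ, r ^ ℓ ≠ w) :
    Module.finrank ℚ E * (ℓ * (ℓ - 1)) ∣ Module.finrank ℚ ↥(E ⊔ kummerField Ω W ℓ) := by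
  have hℓ : ℓ.Prime := Fact.out
  have : NeZero (ℓ : Ω) := ⟨by exact_mod_cast hℓ.ne_zero⟩
  have hle : E ≤ E ⊔ kummerField Ω W ℓ := le_sup_left
  obtain ⟨ζ, hζ⟩ := HasEnoughRootsOfUnity.exists_primitiveRoot Ω ℓ
  obtain ⟨z, hz⟩ := IsAlgClosed.exists_pow_nat_eq ((w : ℚ) : Ω) hℓ.pos
  have hcyc := irreducible_cyclotomic_of_le_unramifiedField hE
  have hζmin : cyclotomic ℓ E = minpoly E ζ := by
    refine minpoly.eq_of_irreducible_of_monic hcyc ?_ (cyclotomic.monic _ _)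
    rw [aeval_def, ← eval_map, map_cyclotomic]
    exact hζ.isRoot_cyclotomic hℓ.pos
  -- The degree of ζ over E is ℓ - 1, which exceeds 1 because ℓ > 2.
  have hζE : ζ ∉ E := fun h => by
    have h1 := minpoly.eq_X_sub_C Ω (⟨ζ, h⟩ : E)
    have h3 := congrArg natDegree (hζmin.trans h1)
    rw [natDegree_cyclotomic, Nat.totient_prime hℓ, natDegree_X_sub_C] at h3
    omega
  -- An ℓ-th root b of w in E would, by normality, bring its conjugate ζb into E, hence also ζ.
  have hirr : Irreducible (X ^ ℓ - C ((w : ℚ) : E)) := by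
    refine X_pow_sub_C_irreducible_of_prime hℓ fun b hb => ?_
    have hirrQ := X_pow_sub_C_irreducible_of_prime hℓ hpow
    have hb' : aeval b (X ^ ℓ - C (w : ℚ)) = 0 := by simp [hb]
    have hmin := minpoly.eq_of_irreducible_of_monic hirrQ hb' (monic_X_pow_sub_C _ hℓ.ne_zero)
    have hspl := Normal.splits (inferInstance : Normal ℚ E) b
    rw [← hmin] at hspl
    have hbΩ : (b : Ω) ^ ℓ = ((w : ℚ) : Ω) := by
      have := congrArg (algebraMap E Ω) hb
      simpa using this
    have hb0 : (b : Ω) ≠ 0 := fun h => by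
      rw [h, zero_pow hℓ.ne_zero] at hbΩ
      exact w.ne_zero (by exact_mod_cast hbΩ.symm)
    have hmem : ζ * b ∈ E := by
      obtain ⟨y, hy⟩ := hspl.mem_range_of_isRoot (i := algebraMap E Ω) (x := ζ * b)
        ((monic_X_pow_sub_C _ hℓ.ne_zero).map _).ne_zero
        (by simp [IsRoot, mul_pow, hζ.pow_eq_one, hbΩ])
      exact hy ▸ y.2
    have := mul_mem hmem (inv_mem b.2)
    rw [mul_inv_cancel_right₀ hb0] at this
    exact hζE this
  have hzmin : X ^ ℓ - C ((w : ℚ) : E) = minpoly E z :=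
    minpoly.eq_of_irreducible_of_monic hirr (by simp [hz]) (monic_X_pow_sub_C _ hℓ.ne_zero)
  have hdeg : ∀ x ∈ E ⊔ kummerField Ω W ℓ, IsIntegral E x →
      (minpoly E x).natDegree ∣ Module.finrank E (extendScalars hle) := fun x hx hint => by
    have := minpoly.degree_dvd (K := E) (x := (⟨x, hx⟩ : extendScalars hle))
      ((isIntegral_algHom_iff (extendScalars hle).val Subtype.val_injective).1 hint)
    rwa [← minpoly.algebraMap_eq (B' := Ω) (algebraMap (extendScalars hle) Ω).injective] at this
  have h1 : ℓ - 1 ∣ Module.finrank E (extendScalars hle) := by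
    have := hdeg ζ (le_sup_right (a := E) (subset_adjoin _ _ (Or.inl hζ)))
      (hζ.isIntegral hℓ.pos).tower_top
    rwa [← hζmin, natDegree_cyclotomic, Nat.totient_prime hℓ] at this
  have h3 : ℓ ∣ Module.finrank E (extendScalars hle) := by
    have := hdeg z (le_sup_right (a := E) (mem_kummerField hw hz))
      (isIntegral_of_pow_eq hℓ.pos hz).tower_top
    rwa [← hzmin, natDegree_X_pow_sub_C] at this
  have hcop : Nat.Coprime ℓ (ℓ - 1) := by
    rw [Nat.coprime_self_sub_right hℓ.one_le]; simp
  have h4 := hcop.mul_dvd_of_dvd_of_dvd h3 h1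
  have h5 := Module.finrank_mul_finrank ℚ E (extendScalars hle)
  have h6 : Module.finrank ℚ (extendScalars hle) = Module.finrank ℚ ↥(E ⊔ kummerField Ω W ℓ) := rfl
  rw [← h6, ← h5]
  exact Nat.mul_dvd_mul_left _ h4

end IsAlgClosed

end MultiArtin

/-! ### Counting in Galois groups -/

namespace MultiArtin

open IntermediateField

/-- A set-theoretic section of ρ identifies the preimage of T with T × ker ρ. -/
theorem card_preimage_mul_card {G H : Type*} [Group G] [Group H] (ρ : G →* H)
    (hρ : Function.Surjective ρ) (S : Set H) :
    Nat.card (ρ ⁻¹' S) * Nat.card H = Nat.card S * Nat.card G := by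
  have key : ∀ T : Set H, Nat.card (ρ ⁻¹' T) = Nat.card T * Nat.card ρ.ker := fun T => by
    rw [← Nat.card_prod]
    refine Nat.card_congr
      { toFun := fun g => ⟨⟨ρ g, g.2⟩, ⟨(Function.surjInv hρ (ρ g))⁻¹ * g, ?_⟩⟩
        invFun := fun x => ⟨Function.surjInv hρ x.1 * x.2, ?_⟩
        left_inv := fun g => ?_
        right_inv := fun x => ?_ }
    · rw [MonoidHom.mem_ker, map_mul, map_inv, Function.surjInv_eq hρ, inv_mul_cancel]
    · rw [Set.mem_preimage, map_mul, Function.surjInv_eq hρ, MonoidHom.mem_ker.1 x.2.2, mul_one]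
      exact x.1.2
    · ext; simp
    · have h : ρ (Function.surjInv hρ x.1 * x.2) = x.1 := by
        rw [map_mul, Function.surjInv_eq hρ, MonoidHom.mem_ker.1 x.2.2, mul_one]
      ext <;> simp [h]
  have h1 := key S
  have h2 := key Set.univ
  rw [Set.preimage_univ, Nat.card_univ, Nat.card_univ] at h2
  rw [h1, h2]
  ring

/-- The terms telescope: 1/(ℓ(ℓ-1)) = 1/(ℓ-1) - 1/ℓ. -/
theorem finset_sum_one_div_mul_pred_le (x : ℕ) (hx : 0 < x) (s : Finset ℕ)
    (hs : ∀ ℓ ∈ s, x < ℓ) : ∑ ℓ ∈ s, (1 : ℝ) / (ℓ * (ℓ - 1 : ℕ)) ≤ 1 / x := by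
  have htel : ∀ m : ℕ, ∑ ℓ ∈ Finset.Ioc x (x + m), (1 : ℝ) / (ℓ * (ℓ - 1 : ℕ)) =
      1 / x - 1 / (x + m : ℕ) := fun m => by
    induction m with
    | zero => simp
    | succ m ih =>
      rw [← add_assoc, ← Finset.insert_Ioc_right_eq_Ioc_add_one (by omega),
        Finset.sum_insert (by simp), ih]
      have h0 : ((x + m : ℕ) : ℝ) ≠ 0 := by positivity
      have h1 : ((x + m : ℕ) : ℝ) + 1 ≠ 0 := by positivity
      rw [Nat.add_sub_cancel, Nat.cast_add_one]
      field_simp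
      ring
  have hsub : s ⊆ Finset.Ioc x (x + s.sup id) := fun ℓ hℓ => by
    have : ℓ ≤ s.sup id := Finset.le_sup (f := id) hℓ
    exact Finset.mem_Ioc.2 ⟨hs ℓ hℓ, by omega⟩
  refine (Finset.sum_le_sum_of_subset_of_nonneg hsub fun _ _ _ => by positivity).trans ?_
  rw [htel]
  exact sub_le_self _ (by positivity)

variable {Ω : Type*} [Field Ω] [CharZero Ω]

theorem exists_restriction {E E' : IntermediateField ℚ Ω} [Normal ℚ E] [Normal ℚ E'] (h : E ≤ E') :
    ∃ ρ : (E' ≃ₐ[ℚ] E') →* (E ≃ₐ[ℚ] E), Function.Surjective ρ ∧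
      ∀ σ x, inclusion h (ρ σ x) = σ (inclusion h x) := by
  let _ : Algebra E E' := (inclusion h).toRingHom.toAlgebra
  have : IsScalarTower ℚ E E' := IsScalarTower.of_algebraMap_eq' (Subsingleton.elim _ _)
  exact ⟨AlgEquiv.restrictNormalHom E, AlgEquiv.restrictNormalHom_surjective E',
    fun σ x => AlgEquiv.restrictNormal_commutes σ E x⟩

theorem algEquiv_eq_of_eqOn_sup {E K : IntermediateField ℚ Ω}
    {σ τ : ↥(E ⊔ K) ≃ₐ[ℚ] ↥(E ⊔ K)}
    (hE : ∀ x : E, σ (inclusion le_sup_left x) = τ (inclusion le_sup_left x))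
    (hK : ∀ x : K, σ (inclusion le_sup_right x) = τ (inclusion le_sup_right x)) : σ = τ := by
  -- The membership proof is produced inside the induction, since σ and τ are defined only on the
  -- compositum.
  have key : ∀ x (hx : x ∈ adjoin ℚ ((E : Set Ω) ∪ K)), ∃ hx' : x ∈ E ⊔ K,
      σ ⟨x, hx'⟩ = τ ⟨x, hx'⟩ := by
    intro x hx
    induction hx using adjoin_induction with
    | mem x hx =>
      rcases hx with hx | hx
      · exact ⟨_, hE ⟨x, hx⟩⟩
      · exact ⟨_, hK ⟨x, hx⟩⟩
    | algebraMap r =>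
      refine ⟨IntermediateField.algebraMap_mem _ r, ?_⟩
      have : (⟨algebraMap ℚ Ω r, IntermediateField.algebraMap_mem (E ⊔ K) r⟩ : ↥(E ⊔ K)) = (r : ↥(E ⊔ K)) := by
        ext; simp
      rw [this, map_ratCast, map_ratCast]
    | add x y _ _ hx hy =>
      obtain ⟨hx, hx'⟩ := hx
      obtain ⟨hy, hy'⟩ := hy
      exact ⟨add_mem hx hy, (map_add σ ⟨x, hx⟩ ⟨y, hy⟩).trans
        ((congrArg₂ _ hx' hy').trans (map_add τ ⟨x, hx⟩ ⟨y, hy⟩).symm)⟩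
    | inv x _ hx =>
      obtain ⟨hx, hx'⟩ := hx
      exact ⟨inv_mem hx, (map_inv₀ σ ⟨x, hx⟩).trans
        ((congrArg _ hx').trans (map_inv₀ τ ⟨x, hx⟩).symm)⟩
    | mul x y _ _ hx hy =>
      obtain ⟨hx, hx'⟩ := hx
      obtain ⟨hy, hy'⟩ := hy
      exact ⟨mul_mem hx hy, (map_mul σ ⟨x, hx⟩ ⟨y, hy⟩).trans
        ((congrArg₂ _ hx' hy').trans (map_mul τ ⟨x, hx⟩ ⟨y, hy⟩).symm)⟩
  ext x
  obtain ⟨_, h⟩ := key x (by rw [← sup_def]; exact x.2)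
  exact congrArg Subtype.val h

/-- The automorphisms of `E'` that restrict to `S` on `E` and are trivial on `K` have density at
most `|S| / [EK : ℚ]`. -/
theorem card_mul_finrank_sup_le {E K E' : IntermediateField ℚ Ω} [Normal ℚ E]
    [Normal ℚ ↥(E ⊔ K)] [Normal ℚ E'] [FiniteDimensional ℚ E] [FiniteDimensional ℚ ↥(E ⊔ K)]
    [FiniteDimensional ℚ E'] (h : E ⊔ K ≤ E') (S : Set (E ≃ₐ[ℚ] E)) (T : Set (E' ≃ₐ[ℚ] E'))
    (hT : ∀ σ ∈ T, (∃ τ ∈ S, ∀ x : E, σ (inclusion (le_sup_left.trans h) x) =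
      inclusion (le_sup_left.trans h) (τ x)) ∧ ∀ x : E', (x : Ω) ∈ K → σ x = x) :
    Nat.card T * Module.finrank ℚ ↥(E ⊔ K) ≤ Nat.card S * Nat.card (E' ≃ₐ[ℚ] E') := by
  have : IsGalois ℚ ↥(E ⊔ K) := ⟨⟩
  obtain ⟨ρ, hρ, hρx⟩ := exists_restriction h
  obtain ⟨ρ', -, hρx'⟩ := exists_restriction (le_sup_left : E ≤ E ⊔ K)
  let T' : Set (↥(E ⊔ K) ≃ₐ[ℚ] ↥(E ⊔ K)) := {τ | ρ' τ ∈ S ∧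
    ∀ x : K, τ (inclusion le_sup_right x) = inclusion le_sup_right x}
  have hTT' : T ⊆ ρ ⁻¹' T' := by
    intro σ hσ
    obtain ⟨⟨τ, hτ, hτx⟩, hK⟩ := hT σ hσ
    refine ⟨?_, fun x => ?_⟩
    · convert hτ
      ext x
      have h1 := congrArg Subtype.val (hρx' (ρ σ) x)
      have h2 := congrArg Subtype.val (hρx σ (inclusion le_sup_left x))
      have h3 := congrArg Subtype.val (hτx x)
      simp only [coe_inclusion, inclusion_inclusion] at h1 h2 h3
      rw [h1, h2, h3]
    · have h2 := congrArg Subtype.val (hρx σ (inclusion le_sup_right x))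
      rw [hK _ x.2] at h2
      exact Subtype.ext h2
  -- An automorphism of EK that is trivial on K is determined by its restriction to E.
  have hT'S : Nat.card T' ≤ Nat.card S := by
    refine Nat.card_le_card_of_injective (fun τ : T' => (⟨ρ' τ, τ.2.1⟩ : S)) fun τ τ' hττ' => ?_
    refine Subtype.ext (algEquiv_eq_of_eqOn_sup (fun x => ?_) fun x => ?_)
    · rw [← hρx', ← hρx', show ρ' τ = ρ' τ' from congrArg Subtype.val hττ']
    · rw [τ.2.2, τ'.2.2]
  have h1 := card_preimage_mul_card ρ hρ T'
  rw [IsGalois.card_aut_eq_finrank] at h1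
  calc Nat.card T * Module.finrank ℚ ↥(E ⊔ K)
      ≤ Nat.card (ρ ⁻¹' T') * Module.finrank ℚ ↥(E ⊔ K) :=
        Nat.mul_le_mul_right _ (Nat.card_mono (Set.toFinite _) hTT')
    _ = Nat.card T' * Nat.card (E' ≃ₐ[ℚ] E') := h1
    _ ≤ _ := Nat.mul_le_mul_right _ hT'S

end MultiArtin

/-! ### Rational numbers at large primes, and the fields L_n -/

namespace MultiArtin

open IntermediateField

section Rational

theorem padicValRat_eq_zero_of_lt {ℓ : ℕ} {w : ℚ} (hw : w ≠ 0)
    (hnum : w.num.natAbs < ℓ) (hden : w.den < ℓ) : padicValRat ℓ w = 0 := by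
  have h1 : padicValInt ℓ w.num = 0 := padicValNat.eq_zero_of_not_dvd
    (Nat.not_dvd_of_pos_of_lt (Int.natAbs_pos.2 (Rat.num_ne_zero.2 hw)) hnum)
  have h2 : padicValNat ℓ w.den = 0 := padicValNat.eq_zero_of_not_dvd
    (Nat.not_dvd_of_pos_of_lt w.den_pos hden)
  rw [padicValRat, h1, h2]
  rfl

/-- Vanishing of the valuation is stable under the group operations, so only the finitely many
generators matter. -/
theorem exists_bound_padicValRat_eq_zero {W : Subgroup ℚˣ} (hW : W.FG) :
    ∃ B : ℕ, ∀ ℓ : ℕ, ℓ.Prime → B < ℓ → ∀ w ∈ W, padicValRat ℓ (w : ℚ) = 0 := by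
  obtain ⟨S, rfl⟩ := hW
  refine ⟨S.sup fun w => (w : ℚ).num.natAbs + (w : ℚ).den, fun ℓ hℓ hlt w hw => ?_⟩
  have : Fact ℓ.Prime := ⟨hℓ⟩
  induction hw using Subgroup.closure_induction with
  | mem w hw =>
    have := (Finset.le_sup (f := fun w : ℚˣ => (w : ℚ).num.natAbs + (w : ℚ).den) hw).trans_lt hlt
    exact padicValRat_eq_zero_of_lt w.ne_zero (by omega) (by omega)
  | one => simp
  | mul u v _ _ hu hv => rw [Units.val_mul, padicValRat.mul u.ne_zero v.ne_zero, hu, hv, add_zero]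
  | inv u _ hu => rw [Units.val_inv_eq_inv_val, padicValRat.inv, hu, neg_zero]

theorem exists_mem_abs_ne_one (W : Subgroup ℚˣ) [Infinite W] : ∃ w ∈ W, |(w : ℚ)| ≠ 1 := by
  by_contra! h
  have hsub : (W : Set ℚˣ) ⊆ {1, -1} := fun w hw => by
    rcases eq_or_eq_neg_of_abs_eq (h w hw) with h1 | h1
    · exact Or.inl (Units.ext h1)
    · exact Or.inr (Units.ext (by simpa using h1))
  exact Set.infinite_coe_iff.1 (inferInstance : Infinite W) ((Set.toFinite _).subset hsub)

/-- If a ≥ 2 then a^ℓ > ℓ, so an ℓ-th root of w would have numerator ±1 and denominator 1, forcing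
|w| = 1. -/
theorem pow_ne_of_abs_ne_one {w : ℚ} (hw : w ≠ 0) (hw1 : |w| ≠ 1) {ℓ : ℕ}
    (hnum : w.num.natAbs < ℓ) (hden : w.den < ℓ) (r : ℚ) : r ^ ℓ ≠ w := by
  rintro rfl
  rw [Rat.num_pow, Int.natAbs_pow] at hnum
  rw [Rat.den_pow] at hden
  have hsmall : ∀ a : ℕ, a ^ ℓ < ℓ → a ≤ 1 := fun a ha => by
    by_contra! h
    exact (Nat.lt_pow_self h).not_gt ha
  have hr : r ≠ 0 := fun h => hw (by rw [h, zero_pow (by omega)])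
  have h1 : r.num.natAbs = 1 :=
    le_antisymm (hsmall _ hnum) (Int.natAbs_pos.2 (Rat.num_ne_zero.2 hr))
  have h2 : r.den = 1 := le_antisymm (hsmall _ hden) r.den_pos
  apply hw1
  rw [abs_pow, Rat.abs_def, h1, h2]
  simp

theorem exists_bound_pow_ne (W : Subgroup ℚˣ) [Infinite W] :
    ∃ w ∈ W, ∃ B : ℕ, ∀ ℓ : ℕ, B < ℓ → ∀ r : ℚ, r ^ ℓ ≠ w := by
  obtain ⟨w, hw, hw1⟩ := exists_mem_abs_ne_one W
  exact ⟨w, hw, (w : ℚ).num.natAbs + (w : ℚ).den, fun ℓ hℓ =>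
    pow_ne_of_abs_ne_one w.ne_zero hw1 (by omega) (by omega)⟩

end Rational

variable {Ω : Type*} [Field Ω] [CharZero Ω]

/-- The ℚ-algebra structure on a field is unique; this reconciles the different instances carried by
an intermediate field. -/
theorem normal_of_normal_algebra {K : IntermediateField ℚ Ω} {i j : Algebra ℚ K}
    (h : @Normal ℚ K _ _ i) : @Normal ℚ K _ _ j :=
  Subsingleton.elim i j ▸ h

theorem normal_sup_rat {E K : IntermediateField ℚ Ω} (hE : Normal ℚ E) (hK : Normal ℚ K) :
    Normal ℚ ↥(E ⊔ K) :=
  have := normal_of_normal_algebra (j := E.algebra') hE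
  have := normal_of_normal_algebra (j := K.algebra') hK
  normal_of_normal_algebra (IntermediateField.normal_sup ℚ Ω E K)

theorem normal_iSup_rat {ι : Type*} {E : ι → IntermediateField ℚ Ω} (hE : ∀ i, Normal ℚ (E i)) :
    Normal ℚ ↥(⨆ i, E i) :=
  have := fun i => normal_of_normal_algebra (j := (E i).algebra') (hE i)
  normal_of_normal_algebra (IntermediateField.normal_iSup ℚ Ω E)

variable {t : ℕ} {W : Fin t → Subgroup ℚˣ} {k : Fin t → ℕ}

theorem levelField_mono {N n : ℕ} (hn : n ≠ 0) (h : N ∣ n) :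
    levelField Ω W k N ≤ levelField Ω W k n :=
  biSup_mono fun _ hp => Nat.primeFactors_mono h hn hp

theorem kummerField_le_levelField (ht : 0 < t) {n ℓ : ℕ} (hℓ : ℓ ∈ n.primeFactors) (i : Fin t) :
    kummerField Ω (W i) (qPow (k i) ℓ) ≤ levelField Ω W k n := by
  refine le_trans ?_ (le_iSup₂ (f := fun ℓ _ => primeField Ω W k ℓ) ℓ hℓ)
  rw [primeField_eq_iSup ht]
  exact le_iSup (fun i => kummerField Ω (W i) (qPow (k i) ℓ)) i

theorem levelField_le_unramifiedField (ht : 0 < t) (hk : ∀ i, 0 < k i) {ℓ n : ℕ} [Fact ℓ.Prime]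
    (hℓn : ℓ ∉ n.primeFactors) (hW : ∀ i, ∀ w ∈ W i, padicValRat ℓ (w : ℚ) = 0) :
    levelField Ω W k n ≤ unramifiedField Ω ℓ := by
  refine iSup₂_le fun p hp => ?_
  rw [primeField_eq_iSup ht]
  have hp' := Nat.prime_of_mem_primeFactors hp
  exact iSup_le fun i => kummerField_le_unramifiedField (qPow_pos (hk i) hp')
    (not_dvd_qPow (hk i) hp' Fact.out fun h => hℓn (h ▸ hp)) (hW i)

section IsAlgClosed

variable [IsAlgClosed Ω]

theorem normal_levelField (ht : 0 < t) (hk : ∀ i, 0 < k i) (n : ℕ) :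
    Normal ℚ (levelField Ω W k n) := by
  have h : levelField Ω W k n = ⨆ ℓ : n.primeFactors, primeField Ω W k ℓ := iSup_subtype'
  rw [h]
  refine normal_iSup_rat fun ℓ => ?_
  rw [primeField_eq_iSup ht]
  exact normal_iSup_rat fun i =>
    normal_kummerField _ (qPow_pos (hk i) (Nat.prime_of_mem_primeFactors ℓ.2))

theorem finiteDimensional_levelField (ht : 0 < t) (hW : ∀ i, (W i).FG) (hk : ∀ i, 0 < k i)
    (n : ℕ) : FiniteDimensional ℚ (levelField Ω W k n) := by
  refine finiteDimensional_iSup_of_finset' fun ℓ hℓ => ?_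
  rw [primeField_eq_iSup ht]
  have := fun i => finiteDimensional_kummerField (Ω := Ω) (hW i)
    (qPow_pos (hk i) (Nat.prime_of_mem_primeFactors hℓ))
  exact finiteDimensional_iSup_of_finite

end IsAlgClosed

/-! ### Comparing C_N and C_n -/

section Density

variable {F : IntermediateField ℚ Ω} {C : Set (F ≃ₐ[ℚ] F)}

theorem localSet_subset_preimage (ht : 0 < t) {N n : ℕ} (hn : n ≠ 0) (h : N ∣ n)
    (hle : F ⊔ levelField Ω W k N ≤ F ⊔ levelField Ω W k n)
    {ρ : (↥(F ⊔ levelField Ω W k n) ≃ₐ[ℚ] ↥(F ⊔ levelField Ω W k n)) →*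
      (↥(F ⊔ levelField Ω W k N) ≃ₐ[ℚ] ↥(F ⊔ levelField Ω W k N))}
    (hρ : ∀ σ x, inclusion hle (ρ σ x) = σ (inclusion hle x)) :
    localSet W k F C n ⊆ ρ ⁻¹' localSet W k F C N := by
  rintro σ ⟨⟨τ, hτ, hτx⟩, hσ⟩
  refine ⟨⟨τ, hτ, fun x => inclusion_injective hle ?_⟩, fun ℓ hℓ i hi => ?_⟩
  · rw [hρ, inclusion_inclusion, inclusion_inclusion, hτx]
  · refine hσ ℓ (Nat.primeFactors_mono h hn hℓ) i fun x hx => ?_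
    have hxN : (x : Ω) ∈ F ⊔ levelField Ω W k N :=
      le_sup_right (a := F) (kummerField_le_levelField ht hℓ i hx)
    have hincl : inclusion hle ⟨x, hxN⟩ = x := Subtype.ext (coe_inclusion hle ⟨x, hxN⟩)
    have := hρ σ ⟨x, hxN⟩
    rw [hi ⟨x, hxN⟩ hx, hincl] at this
    exact this.symm

/-- A lift of an element of C_N can leave C_n only by being trivial on some Kummer field at a prime
dividing n, and that prime cannot divide N. -/
theorem preimage_subset_localSet_union {N n : ℕ}
    (hle : F ⊔ levelField Ω W k N ≤ F ⊔ levelField Ω W k n)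
    {ρ : (↥(F ⊔ levelField Ω W k n) ≃ₐ[ℚ] ↥(F ⊔ levelField Ω W k n)) →*
      (↥(F ⊔ levelField Ω W k N) ≃ₐ[ℚ] ↥(F ⊔ levelField Ω W k N))}
    (hρ : ∀ σ x, inclusion hle (ρ σ x) = σ (inclusion hle x)) :
    ρ ⁻¹' localSet W k F C N ⊆ localSet W k F C n ∪
      ⋃ p ∈ (n.primeFactors \ N.primeFactors) ×ˢ (Finset.univ : Finset (Fin t)),
        {σ | ρ σ ∈ localSet W k F C N ∧ ∀ x : ↥(F ⊔ levelField Ω W k n),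
          (x : Ω) ∈ kummerField Ω (W p.2) (qPow (k p.2) p.1) → σ x = x} := by
  intro σ hσ
  by_cases hcon : ∃ ℓ ∈ n.primeFactors, ∃ i : Fin t, ∀ x : ↥(F ⊔ levelField Ω W k n),
    (x : Ω) ∈ kummerField Ω (W i) (qPow (k i) ℓ) → σ x = x
  · obtain ⟨ℓ, hℓ, i, hi⟩ := hcon
    have hℓN : ℓ ∉ N.primeFactors := fun hℓN => by
      refine hσ.2 ℓ hℓN i fun x hx => inclusion_injective hle ?_
      have hx' : (inclusion hle x : Ω) ∈ kummerField Ω (W i) (qPow (k i) ℓ) := by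
        rw [coe_inclusion]; exact hx
      exact (hρ σ x).trans (hi _ hx')
    refine Or.inr (Set.mem_iUnion₂.2 ⟨(ℓ, i), ?_, ?_⟩)
    · exact Finset.mem_product.2 ⟨Finset.mem_sdiff.2 ⟨hℓ, hℓN⟩, Finset.mem_univ i⟩
    · exact And.intro hσ hi
  · push Not at hcon
    refine Or.inl ?_
    obtain ⟨⟨τ, hτ, hτx⟩, -⟩ := hσ
    refine And.intro ⟨τ, hτ, fun x => ?_⟩ fun ℓ hℓ i hi => ?_
    · have := congrArg (inclusion hle) (hτx x)
      rwa [hρ, inclusion_inclusion, inclusion_inclusion] at this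
    · obtain ⟨x, hx, hne⟩ := hcon ℓ hℓ i
      exact hne (hi x hx)

end Density

end MultiArtin

/-! ### Density estimates -/

namespace MultiArtin

open IntermediateField

variable {Ω : Type*} [Field Ω] [CharZero Ω] [IsAlgClosed Ω] {t : ℕ} {W : Fin t → Subgroup ℚˣ}
  {k : Fin t → ℕ} {F : IntermediateField ℚ Ω} {C : Set (F ≃ₐ[ℚ] F)}

theorem localDensity_antitone (ht : 0 < t) (hW : ∀ i, (W i).FG) (hk : ∀ i, 0 < k i)
    [FiniteDimensional ℚ F] [IsGalois ℚ F] {N n : ℕ} (hn : n ≠ 0) (h : N ∣ n) :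
    localDensity W k F C n ≤ localDensity W k F C N := by
  have := normal_sup_rat (inferInstance : Normal ℚ F) (normal_levelField (Ω := Ω) (W := W) ht hk N)
  have := normal_sup_rat (inferInstance : Normal ℚ F) (normal_levelField (Ω := Ω) (W := W) ht hk n)
  have := finiteDimensional_levelField (Ω := Ω) ht hW hk N
  have := finiteDimensional_levelField (Ω := Ω) ht hW hk n
  have hle : F ⊔ levelField Ω W k N ≤ F ⊔ levelField Ω W k n :=
    sup_le_sup_left (levelField_mono hn h) F
  obtain ⟨ρ, hρ, hρx⟩ := exists_restriction hle
  have h1 := card_preimage_mul_card ρ hρ (localSet W k F C N)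
  have h2 : Nat.card (localSet W k F C n) ≤ Nat.card (ρ ⁻¹' localSet W k F C N) :=
    Nat.card_mono (Set.toFinite _) (localSet_subset_preimage ht hn h hle hρx)
  rw [localDensity, localDensity, div_le_div_iff₀ (by exact_mod_cast Nat.card_pos)
    (by exact_mod_cast Nat.card_pos)]
  exact_mod_cast (Nat.mul_le_mul_right _ h2).trans h1.le

theorem localDensity_sub_le (ht : 0 < t) (hW : ∀ i, (W i).FG) (hk : ∀ i, 0 < k i)
    [FiniteDimensional ℚ F] [IsGalois ℚ F] {N n : ℕ} (hn : n ≠ 0) (h : N ∣ n)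
    (hunram : ∀ ℓ ∈ n.primeFactors \ N.primeFactors,
      F ⊔ levelField Ω W k N ≤ unramifiedField Ω ℓ)
    (h2 : ∀ ℓ ∈ n.primeFactors \ N.primeFactors, 2 < ℓ)
    (hq : ∀ ℓ ∈ n.primeFactors \ N.primeFactors, ∀ i, qPow (k i) ℓ = ℓ)
    (hpow : ∀ ℓ ∈ n.primeFactors \ N.primeFactors, ∀ i, ∃ w ∈ W i, ∀ r : ℚ, r ^ ℓ ≠ w) :
    localDensity W k F C N * (1 - t * ∑ ℓ ∈ n.primeFactors \ N.primeFactors,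
      (1 : ℝ) / (ℓ * (ℓ - 1 : ℕ))) ≤ localDensity W k F C n := by
  have hNN := normal_sup_rat (inferInstance : Normal ℚ F)
    (normal_levelField (Ω := Ω) (W := W) ht hk N)
  have hNn := normal_sup_rat (inferInstance : Normal ℚ F)
    (normal_levelField (Ω := Ω) (W := W) ht hk n)
  have := finiteDimensional_levelField (Ω := Ω) ht hW hk N
  have := finiteDimensional_levelField (Ω := Ω) ht hW hk n
  have hle : F ⊔ levelField Ω W k N ≤ F ⊔ levelField Ω W k n :=
    sup_le_sup_left (levelField_mono hn h) F
  obtain ⟨ρ, hρ, hρx⟩ := exists_restriction hle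
  have hGal : IsGalois ℚ ↥(F ⊔ levelField Ω W k N) := ⟨⟩
  set P := n.primeFactors \ N.primeFactors
  set GN := (Nat.card (↥(F ⊔ levelField Ω W k N) ≃ₐ[ℚ] ↥(F ⊔ levelField Ω W k N)) : ℝ)
  set Gn := (Nat.card (↥(F ⊔ levelField Ω W k n) ≃ₐ[ℚ] ↥(F ⊔ levelField Ω W k n)) : ℝ)
  set cN := (Nat.card (localSet W k F C N) : ℝ)
  set cn := (Nat.card (localSet W k F C n) : ℝ)
  have hGN0 : 0 < GN := Nat.cast_pos.2 Nat.card_pos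
  have hGn0 : 0 < Gn := Nat.cast_pos.2 Nat.card_pos
  let T : ℕ × Fin t → Set (↥(F ⊔ levelField Ω W k n) ≃ₐ[ℚ] ↥(F ⊔ levelField Ω W k n)) := fun p =>
    {σ | ρ σ ∈ localSet W k F C N ∧ ∀ x : ↥(F ⊔ levelField Ω W k n),
      (x : Ω) ∈ kummerField Ω (W p.2) (qPow (k p.2) p.1) → σ x = x}
  -- The right side is the number of lifts of C_N divided by ℓ(ℓ-1): triviality on the Kummer field
  -- is a condition over F L_N of degree at least ℓ(ℓ-1).
  have hT : ∀ p ∈ P ×ˢ (Finset.univ : Finset (Fin t)),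
      (Nat.card (T p) : ℝ) ≤ cN * Gn / GN * (1 / (p.1 * (p.1 - 1 : ℕ))) := by
    rintro ⟨ℓ, i⟩ hp
    have hℓ : ℓ ∈ P := (Finset.mem_product.1 hp).1
    have hℓn : ℓ ∈ n.primeFactors := (Finset.mem_sdiff.1 hℓ).1
    have : Fact ℓ.Prime := ⟨Nat.prime_of_mem_primeFactors hℓn⟩
    have hℓ2 := h2 ℓ hℓ
    obtain ⟨w, hw, hwr⟩ := hpow ℓ hℓ i
    have hKle : kummerField Ω (W i) ℓ ≤ levelField Ω W k n := by
      have := kummerField_le_levelField (Ω := Ω) (W := W) (k := k) ht hℓn i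
      rwa [hq ℓ hℓ i] at this
    have := finiteDimensional_kummerField (Ω := Ω) (hW i) (by omega : 0 < ℓ)
    have := normal_sup_rat hNN (normal_kummerField (Ω := Ω) (W i) (by omega : 0 < ℓ))
    have hsup : F ⊔ levelField Ω W k N ⊔ kummerField Ω (W i) ℓ ≤ F ⊔ levelField Ω W k n :=
      sup_le hle (hKle.trans le_sup_right)
    have hcard := card_mul_finrank_sup_le hsup (localSet W k F C N) (T (ℓ, i))
      fun σ hσ => by
        refine ⟨⟨ρ σ, hσ.1, fun x => (hρx σ x).symm⟩, fun x hx => hσ.2 x ?_⟩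
        rwa [hq ℓ hℓ i]
    have hdvd := mul_dvd_finrank_sup_kummerField hℓ2 (hunram ℓ hℓ) hw hwr
    rw [← IsGalois.card_aut_eq_finrank] at hdvd
    have hcard' := (Nat.mul_le_mul_left (Nat.card (T (ℓ, i)))
      (Nat.le_of_dvd Module.finrank_pos hdvd)).trans hcard
    have hreal : (Nat.card (T (ℓ, i)) : ℝ) * (GN * (ℓ * (ℓ - 1 : ℕ))) ≤ cN * Gn := by
      have := Nat.cast_le (α := ℝ).2 hcard'
      simp only [Nat.cast_mul] at this
      exact this
    have hpos : (0 : ℝ) < ℓ * (ℓ - 1 : ℕ) := by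
      exact_mod_cast Nat.mul_pos (by omega : 0 < ℓ) (by omega : 0 < ℓ - 1)
    rw [mul_one_div, div_div, le_div_iff₀ (by positivity)]
    exact hreal
  have hcover : (Nat.card (ρ ⁻¹' localSet W k F C N) : ℝ) ≤
      cn + ∑ p ∈ P ×ˢ (Finset.univ : Finset (Fin t)), (Nat.card (T p) : ℝ) := by
    have h1 : (ρ ⁻¹' localSet W k F C N).ncard ≤ (localSet W k F C n).ncard +
        ∑ p ∈ P ×ˢ (Finset.univ : Finset (Fin t)), (T p).ncard :=
      (Set.ncard_le_ncard (preimage_subset_localSet_union hle hρx) (Set.toFinite _)).trans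
        ((Set.ncard_union_le _ _).trans
          (Nat.add_le_add_left (Finset.set_ncard_biUnion_le _ _) _))
    have h2 := Nat.cast_le (α := ℝ).2 h1
    rw [Nat.cast_add, Nat.cast_sum] at h2
    exact h2
  have hpre : (Nat.card (ρ ⁻¹' localSet W k F C N) : ℝ) * GN = cN * Gn := by
    have h1 := congrArg (Nat.cast (R := ℝ)) (card_preimage_mul_card ρ hρ (localSet W k F C N))
    rw [Nat.cast_mul, Nat.cast_mul] at h1
    exact h1
  have hsum : ∑ p ∈ P ×ˢ (Finset.univ : Finset (Fin t)), (Nat.card (T p) : ℝ) ≤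
      cN * Gn / GN * (t * ∑ ℓ ∈ P, (1 : ℝ) / (ℓ * (ℓ - 1 : ℕ))) := by
    refine (Finset.sum_le_sum hT).trans_eq ?_
    rw [← Finset.mul_sum, Finset.sum_product]
    simp [Finset.mul_sum]
  change cN / GN * _ ≤ cn / Gn
  rw [le_div_iff₀ hGn0]
  have hpre' : (Nat.card (ρ ⁻¹' localSet W k F C N) : ℝ) = cN * Gn / GN := by
    rw [eq_div_iff hGN0.ne', hpre]
  have := (hpre' ▸ hcover).trans (add_le_add_right hsum cn)
  calc cN / GN * (1 - t * ∑ ℓ ∈ P, (1 : ℝ) / (ℓ * (ℓ - 1 : ℕ))) * Gn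
      = cN * Gn / GN - cN * Gn / GN * (t * ∑ ℓ ∈ P, (1 : ℝ) / (ℓ * (ℓ - 1 : ℕ))) := by ring
    _ ≤ cn := by linarith

/-- The local densities at the multiples of a suitable primorial `N` are at least half of the one
at `N`. -/
theorem exists_half_localDensity_le (ht : 0 < t) (hWfg : ∀ i, (W i).FG)
    (hWinf : ∀ i, Infinite (W i)) (hk : ∀ i, 0 < k i) [FiniteDimensional ℚ F] [IsGalois ℚ F] :
    ∃ N : ℕ, Squarefree N ∧ ∀ n : ℕ, n ≠ 0 → N ∣ n →
      localDensity W k F C N / 2 ≤ localDensity W k F C n := by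
  obtain ⟨BF, hBF⟩ := exists_bound_le_unramifiedField F
  choose BW hBW using fun i => exists_bound_padicValRat_eq_zero (hWfg i)
  choose w hw Bw hBw using fun i => exists_bound_pow_ne (W i)
  -- The bound 2t ≤ x controls the tail and, as t > 0, forces ℓ > 2 for ℓ > x; the others give
  -- unramifiedness, the absence of ℓ-th roots, and q_i(ℓ) = ℓ.
  obtain ⟨x, hx⟩ : ∃ x, 2 * t ≤ x ∧ BF ≤ x ∧ ∀ i, BW i ≤ x ∧ Bw i ≤ x ∧ k i ≤ x := by
    refine ⟨2 * t + BF + ∑ i, (BW i + Bw i + k i), by omega, by omega, fun i => ?_⟩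
    have := Finset.single_le_sum (f := fun i => BW i + Bw i + k i) (fun _ _ => Nat.zero_le _)
      (Finset.mem_univ i)
    omega
  obtain ⟨hxt, hxF, hxi⟩ := hx
  refine ⟨primorial x, squarefree_primorial x, fun n hn hdvd => ?_⟩
  have hP : ∀ ℓ ∈ n.primeFactors \ (primorial x).primeFactors,
      ℓ.Prime ∧ x < ℓ ∧ ℓ ∉ (primorial x).primeFactors := by
    intro ℓ hℓ
    obtain ⟨h1, h2⟩ := Finset.mem_sdiff.1 hℓ
    have hℓp := Nat.prime_of_mem_primeFactors h1
    refine ⟨hℓp, ?_, h2⟩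
    rw [primeFactors_primorial, Nat.mem_primesLE] at h2
    by_contra! hle
    exact h2 ⟨hle, hℓp⟩
  have key := localDensity_sub_le (C := C) ht hWfg hk hn hdvd
    (fun ℓ hℓ => by
      obtain ⟨hp, hlt, hnot⟩ := hP ℓ hℓ
      have : Fact ℓ.Prime := ⟨hp⟩
      exact sup_le (hBF ℓ hp (by omega)) (levelField_le_unramifiedField ht hk hnot
        fun i => hBW i ℓ hp ((hxi i).1.trans_lt hlt)))
    (fun ℓ hℓ => by have := (hP ℓ hℓ).2.1; omega)
    (fun ℓ hℓ i => by
      obtain ⟨hp, hlt, -⟩ := hP ℓ hℓ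
      exact qPow_eq_self (Nat.not_dvd_of_pos_of_lt (hk i) ((hxi i).2.2.trans_lt hlt)))
    (fun ℓ hℓ i => ⟨w i, hw i, hBw i ℓ ((hxi i).2.1.trans_lt (hP ℓ hℓ).2.1)⟩)
  refine le_trans ?_ key
  have hsum := finset_sum_one_div_mul_pred_le x (by omega) _ fun ℓ hℓ => (hP ℓ hℓ).2.1
  have hd0 : 0 ≤ localDensity W k F C (primorial x) := by unfold localDensity; positivity
  have hx0 : (0 : ℝ) < x := by exact_mod_cast (by omega : 0 < x)
  have hxt' : (2 : ℝ) * t ≤ x := by exact_mod_cast hxt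
  have htx : (t : ℝ) * (1 / x) ≤ 1 / 2 := by
    rw [mul_one_div, div_le_div_iff₀ hx0 two_pos]
    linarith
  have hts := (mul_le_mul_of_nonneg_left hsum (Nat.cast_nonneg (α := ℝ) t)).trans htx
  rw [div_eq_mul_one_div]
  exact mul_le_mul_of_nonneg_left (by linarith) hd0

end MultiArtin

/-! ### The limit -/

theorem mainTheorem3 {Ω : Type*} [Field Ω] [CharZero Ω] [IsAlgClosed Ω]
    {t : ℕ} (ht : 0 < t)
    (W : Fin t → Subgroup ℚˣ) (hWfg : ∀ i, (W i).FG) (hWinf : ∀ i, Infinite (W i))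
    (k : Fin t → ℕ) (hk : ∀ i, 0 < k i)
    (F : IntermediateField ℚ Ω) [FiniteDimensional ℚ F] [IsGalois ℚ F]
    (C : Set (F ≃ₐ[ℚ] F)) (hC : ∀ σ ∈ C, ∀ τ : F ≃ₐ[ℚ] F, τ * σ * τ⁻¹ ∈ C)
    (hd : ∀ n : ℕ, Squarefree n → MultiArtin.localDensity W k F C n ≠ 0) :
    ∃ dInf : ℝ, MultiArtin.IsSquarefreeLimit (MultiArtin.localDensity W k F C) dInf ∧
      dInf ≠ 0 := by
  obtain ⟨N, hN, hhalf⟩ := MultiArtin.exists_half_localDensity_le (C := C) ht hWfg hWinf hk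
  set d := MultiArtin.localDensity W k F C
  have hnonneg : ∀ n, 0 ≤ d n := fun n => div_nonneg (Nat.cast_nonneg _) (Nat.cast_nonneg _)
  have hanti : ∀ {m n : ℕ}, n ≠ 0 → m ∣ n → d n ≤ d m := fun hn h =>
    MultiArtin.localDensity_antitone ht hWfg hk hn h
  -- Passing to the lcm of N and n carries the bound from multiples of N to all n; both inequalities
  -- used need only that the lcm is nonzero.
  have hlower : ∀ n, Squarefree n → d N / 2 ≤ d n := fun n hn =>
    (hhalf _ (Nat.lcm_ne_zero hN.ne_zero hn.ne_zero) (Nat.dvd_lcm_left N n)).trans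
      (hanti (Nat.lcm_ne_zero hN.ne_zero hn.ne_zero) (Nat.dvd_lcm_right N n))
  have hne : (d '' {n | Squarefree n}).Nonempty := ⟨d N, N, hN, rfl⟩
  have hbdd : BddBelow (d '' {n | Squarefree n}) :=
    ⟨0, by rintro _ ⟨n, -, rfl⟩; exact hnonneg n⟩
  -- By monotonicity, once some d_M is within ε of the infimum, so is d_n for every squarefree
  -- multiple n of M.
  refine ⟨sInf (d '' {n | Squarefree n}), fun ε hε => ?_, ?_⟩
  · obtain ⟨_, ⟨M, hM, rfl⟩, hlt⟩ := Real.lt_sInf_add_pos hne hε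
    refine ⟨M, hM, fun n hn hMn => ?_⟩
    have h1 : sInf (d '' {n | Squarefree n}) ≤ d n := csInf_le hbdd ⟨n, hn, rfl⟩
    have h2 := hanti hn.ne_zero hMn
    rw [abs_lt]
    constructor <;> linarith
  · have h1 : d N / 2 ≤ sInf (d '' {n | Squarefree n}) :=
      le_csInf hne (by rintro _ ⟨n, hn, rfl⟩; exact hlower n hn)
    have h2 : 0 < d N := lt_of_le_of_ne (hnonneg N) (hd N hN).symm
    exact (lt_of_lt_of_le (half_pos h2) h1).ne'
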